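/- Let $n\ge k\ge 0$ be integers and work in the field $K=\mathbb R(x_1,\dots,x_n,q,t)$. For $i\ge 1$ let the power sum $\Psi_i$ act on $K$ by the field endomorphism over $\mathbb R$ with $x_j\mapsto x_j^i$, $q\mapsto q^i$, $t\mapsto t^i$; since the ring of symmetric functions (with real coefficients) is the polynomial ring $\mathbb R[\Psi_1,\Psi_2,\dots]$, this defines $f[P]\in K$ for every symmetric function $f$ and every $P\in K$. Let $S_h$ be the complete symmetric function of degree $h$ ($S_0=1$, $hS_h=\sum_{r=1}^h\Psi_rS_{h-r}$, and $S_h=0$ for $h<0$), and let $S_\lambda=\det\bigl(S_{\lambda_i-i+j}\bigr)_{1\le i,j\le \ell(\lambda)}$ be the Schur function of a partition $\lambda$, where $\ell(\lambda)$ is the number of its (positive) parts. Put $$X=x_1+\cdots+x_n,\qquad X^{tq}=X\,\frac{t-1}{q-1},\qquad X^t=X(t-1).$$ For $J\subseteq\{1,\dots,n\}$ let $\Theta_J$ be the substitution $x_j\mapsto qx_j$ for all $j\in J$ (all other variables being fixed), and for $I\subseteq\{1,\dots,n\}$ and $l\ge0$ let $$M_l^{(I)}=t^{\binom l2}\sum_{J\subseteq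 I,\ |J|=l}\ \prod_{i\in J,\ j\in I\setminus J}\frac{tx_i-x_j}{x_i-x_j}\ \Theta_J .$$ The creation operator is $$B_k^{(n)}=\sum_{I\subseteq\{1,\dots,n\},\ |I|=k}\ \sum_{l=0}^k(-t)^l\Bigl(\prod_{i\in I}x_i\Bigr)\prod_{i\in I,\ j\notin I}\frac{x_i-x_j/t}{x_i-x_j}\ M_l^{(I)} .$$ For $a\in\mathbb Z^k$ and $b\in K^k$ let the formal column operator $\left[\begin{smallmatrix}a_1&\cdots&a_k\\ b_1&\cdots&b_k\end{smallmatrix}\right]$ act on $k\times k$ matrices of symbols $S_h[P]$ ($h\in\mathbb Z$, $P\in K$) by replacing every entry $S_h[P]$ of column $j$ by $S_{h+a_j}[P+b_j]$, for $j=1,\dots,k$; it is extended linearly to formal $K$-linear combinations of such matrices, and such a combination is evaluated by taking the determinants of the corresponding matrices over $K$. **Theorem 4.2.** For every partition $\lambda$ with $\ell(\lambda)\le k$ (set $\lambda_i=0$ for $i>\ell(\lambda)$), $$B_k^{(n)}\,S_\lambda[X^{tq}]=\prod_{i=1}^k\left(\begin{bmatrix}\cdots&0&1&0&\cdots\\ \cdots&0&0&0&\cdots\end{bmatrix}-t^{k-i}\begin{bmatrix}\cdots&0&1&0&\cdots\\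 \cdots&0&X^t&0&\cdots\end{bmatrix}\right)S_\lambda[X^{tq}],$$ where in the $i$-th factor the $i$-th column is the only non-zero column of the operators, and where on the right-hand side $S_\lambda[X^{tq}]$ stands for the $k\times k$ Jacobi–Trudi matrix of symbols $\bigl(S_{\lambda_i-i+j}[X^{tq}]\bigr)_{1\le i,j\le k}$, the determinant being evaluated after the operators have acted. Moreover, with $Y=X^{tq}-X$ and $G_h(t^r)=S_h[Y+X]-t^rS_h[Y+X+X^t]$, $$B_k^{(n)}\,S_\lambda[X^{tq}]=\det\Bigl(G_{\lambda_i-i+j+1}(t^{k-j})\Bigr)_{1\le i,j\le k}.$$ -/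

import Mathlib

noncomputable section

namespace CreationOperator

open Finset

/-! ### The field of rational functions in `x_1, …, x_n, q, t` over `ℝ` -/

/-- The indeterminates `x_1, …, x_n` (indexed from `0`), `q` and `t`. -/
inductive Var (n : ℕ) : Type
  | x (i : Fin n) : Var n
  | q : Var n
  | t : Var n

/-- The field `ℝ(x_1, …, x_n, q, t)`. -/
abbrev RatFun (n : ℕ) : Type := FractionRing (MvPolynomial (Var n) ℝ)

/-- An indeterminate, as a rational function. -/
def var {n : ℕ} (v : Var n) : RatFun n :=
  algebraMap (MvPolynomial (Var n) ℝ) (RatFun n) (MvPolynomial.X v)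

/-- The variable `x_i`. -/
def xVar {n : ℕ} (i : Fin n) : RatFun n := var (Var.x i)

/-- The parameter `q`. -/
def qVar (n : ℕ) : RatFun n := var Var.q

/-- The parameter `t`. -/
def tVar (n : ℕ) : RatFun n := var Var.t

theorem var_injective_alg {n : ℕ} :
    Function.Injective (MvPolynomial.aeval var : MvPolynomial (Var n) ℝ →ₐ[ℝ] RatFun n) := by
  have h : (MvPolynomial.aeval var : MvPolynomial (Var n) ℝ →ₐ[ℝ] RatFun n)
      = IsScalarTower.toAlgHom ℝ (MvPolynomial (Var n) ℝ) (RatFun n) := by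
    apply MvPolynomial.algHom_ext
    intro v
    simp [var]
  rw [h]
  exact IsFractionRing.injective (MvPolynomial (Var n) ℝ) (RatFun n)

theorem var_ne_zero {n : ℕ} (v : Var n) : (var v : RatFun n) ≠ 0 := by
  intro h
  have h' := IsFractionRing.injective (MvPolynomial (Var n) ℝ) (RatFun n)
    (h.trans (map_zero _).symm)
  exact MvPolynomial.X_ne_zero v h'

/-- For algebraically independent rational functions `y v`, the substitution `v ↦ y v` in
rational functions: the field endomorphism over `ℝ` sending each indeterminate `v` to `y v`. -/
def subst {n : ℕ} (y : Var n → RatFun n) (hy : AlgebraicIndependent ℝ y) :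
    RatFun n →ₐ[ℝ] RatFun n :=
  IsFractionRing.liftAlgHom (K := RatFun n) (g := MvPolynomial.aeval y) hy

theorem subst_var {n : ℕ} (y : Var n → RatFun n) (hy : AlgebraicIndependent ℝ y) (v : Var n) :
    subst y hy (var v) = y v := by
  have h := IsFractionRing.lift_algebraMap (K := RatFun n)
    (g := (MvPolynomial.aeval y : MvPolynomial (Var n) ℝ →ₐ[ℝ] RatFun n).toRingHom) hy
    (MvPolynomial.X v)
  have h' : (MvPolynomial.aeval y : MvPolynomial (Var n) ℝ →ₐ[ℝ] RatFun n)
      (MvPolynomial.X v) = y v := MvPolynomial.aeval_X y v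
  exact Eq.trans h h'

/-! ### Symmetric functions and their action on rational functions -/

theorem algebraicIndependent_pow {n : ℕ} (i : ℕ+) :
    AlgebraicIndependent ℝ (fun v : Var n => (var v : RatFun n) ^ (i : ℕ)) := by
  have h : (MvPolynomial.aeval (fun v : Var n => (var v : RatFun n) ^ (i : ℕ)) :
        MvPolynomial (Var n) ℝ →ₐ[ℝ] RatFun n)
      = (MvPolynomial.aeval var).comp (MvPolynomial.expand (i : ℕ)) := by
    apply MvPolynomial.algHom_ext
    intro v
    simp
  unfold AlgebraicIndependent
  rw [h]
  exact var_injective_alg.comp (MvPolynomial.expand_injective i.pos)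

/-- The action of the `i`-th power sum on rational functions: each monomial `u` in
`x_1, …, x_n, q, t` becomes `u ^ i`, real coefficients being left unchanged. -/
def powerSumAction {n : ℕ} (i : ℕ+) : RatFun n →ₐ[ℝ] RatFun n :=
  subst (fun v => var v ^ (i : ℕ)) (algebraicIndependent_pow i)

/-- The ring of symmetric functions, presented as the polynomial ring on the power sums
`Ψ_1, Ψ_2, …`. -/
abbrev Sym : Type := MvPolynomial ℕ+ ℝ

/-- `f[P]`: the ring of symmetric functions acts on rational functions through the action of the
power sums. -/
def Sym.act {n : ℕ} (f : Sym) (P : RatFun n) : RatFun n :=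
  MvPolynomial.aeval (fun i : ℕ+ => powerSumAction i P) f

/-- The complete symmetric functions of degree `h ≥ 0`, in terms of power sums:
`S_0 = 1` and `h S_h = ∑_{r=1}^{h} Ψ_r S_{h-r}`. -/
def completeNat : ℕ → Sym
  | 0 => 1
  | h + 1 => MvPolynomial.C ((1 : ℝ) / (h + 1)) *
      ∑ r : Fin (h + 1), MvPolynomial.X (Nat.succPNat r) * completeNat (h - r)
  termination_by h => h
  decreasing_by omega

/-- The complete symmetric functions `S_h`, with `S_h = 0` for `h < 0`. -/
def complete : ℤ → Sym
  | Int.ofNat h => completeNat h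
  | Int.negSucc _ => 0

/-- The number of parts of a partition. -/
def numParts (μ : YoungDiagram) : ℕ := μ.colLen 0

/-- The Schur function `S_μ`, as the Jacobi–Trudi determinant whose size is the number of parts
of `μ`. -/
def schur (μ : YoungDiagram) : Sym :=
  Matrix.det (Matrix.of fun i j : Fin (numParts μ) =>
    complete ((μ.rowLen i : ℤ) - (i : ℕ) + (j : ℕ)))

/-- `X = x_1 + ⋯ + x_n`. -/
def X (n : ℕ) : RatFun n := ∑ i, xVar i

/-- `X^{tq} = X (t - 1) / (q - 1)`. -/
def Xtq (n : ℕ) : RatFun n := X n * (tVar n - 1) / (qVar n - 1)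

/-- `X^t = X (t - 1)`. -/
def Xt (n : ℕ) : RatFun n := X n * (tVar n - 1)

/-! ### Macdonald operators and creation operators -/

open Classical in
/-- The indeterminates, with `x_j` multiplied by `q` for every `j ∈ J`. -/
def scaledVar {n : ℕ} (J : Finset (Fin n)) : Var n → RatFun n
  | Var.x j => if j ∈ J then qVar n * xVar j else xVar j
  | Var.q => qVar n
  | Var.t => tVar n

open Classical in
theorem algebraicIndependent_scaledVar {n : ℕ} (J : Finset (Fin n)) :
    AlgebraicIndependent ℝ (scaledVar J) := by
  let y : Var n → RatFun n := fun v => match v with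
    | Var.x j => if j ∈ J then xVar j * (qVar n)⁻¹ else xVar j
    | Var.q => qVar n
    | Var.t => tVar n
  let w : Var n → MvPolynomial (Var n) ℝ := fun v => match v with
    | Var.x j => if j ∈ J then MvPolynomial.X Var.q * MvPolynomial.X (Var.x j)
        else MvPolynomial.X (Var.x j)
    | Var.q => MvPolynomial.X Var.q
    | Var.t => MvPolynomial.X Var.t
  have hq : qVar n ≠ 0 := var_ne_zero _
  have h1 : ((MvPolynomial.aeval y : MvPolynomial (Var n) ℝ →ₐ[ℝ] RatFun n).comp
      (MvPolynomial.aeval w)) = MvPolynomial.aeval var := by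
    apply MvPolynomial.algHom_ext
    intro v
    cases v with
    | x j =>
      by_cases hj : j ∈ J
      · simp only [AlgHom.comp_apply, MvPolynomial.aeval_X, w, y, hj, if_true, map_mul]
        rw [mul_comm (xVar j), mul_inv_cancel_left₀ hq]
        rfl
      · simp only [AlgHom.comp_apply, MvPolynomial.aeval_X, w, y, hj, if_false]
        rfl
    | q => simp [w, y, qVar]
    | t => simp [w, y, tVar]
  have h2 : (MvPolynomial.aeval (scaledVar J) : MvPolynomial (Var n) ℝ →ₐ[ℝ] RatFun n)
      = (MvPolynomial.aeval var).comp (MvPolynomial.aeval w) := by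
    apply MvPolynomial.algHom_ext
    intro v
    cases v with
    | x j =>
      by_cases hj : j ∈ J <;> simp [w, hj, scaledVar, qVar, xVar]
    | q => simp [w, scaledVar, qVar]
    | t => simp [w, scaledVar, tVar]
  have hw : Function.Injective (MvPolynomial.aeval w :
      MvPolynomial (Var n) ℝ →ₐ[ℝ] MvPolynomial (Var n) ℝ) := by
    have h3 : Function.Injective ((MvPolynomial.aeval y : MvPolynomial (Var n) ℝ →ₐ[ℝ] RatFun n).comp
      (MvPolynomial.aeval w)) := by
      rw [h1]
      exact var_injective_alg
    exact Function.Injective.of_comp (f := MvPolynomial.aeval y) h3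
  unfold AlgebraicIndependent
  rw [h2]
  exact var_injective_alg.comp hw

/-- The composite `Θ_J` of the commuting `q`-shifts `Θ_j : x_j ↦ q x_j`, `j ∈ J`. -/
def qShift {n : ℕ} (J : Finset (Fin n)) : RatFun n →ₐ[ℝ] RatFun n :=
  subst (scaledVar J) (algebraicIndependent_scaledVar J)

/-- The resultant `∏_{i ∈ I, j ∈ J} (u_i - v_j)` of the alphabets `{u_i : i ∈ I}` and
`{v_j : j ∈ J}`. -/
def resultant {n : ℕ} (I J : Finset (Fin n)) (u v : Fin n → RatFun n) : RatFun n :=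
  ∏ i ∈ I, ∏ j ∈ J, (u i - v j)

/-- The Macdonald operator `M_l^{(I)}` in the variables `x_i`, `i ∈ I`:
`t^{l(l-1)/2} ∑_{J ⊆ I, |J| = l} R(t X_J, X_{I ∖ J}) / R(X_J, X_{I ∖ J}) Θ_J`. -/
def macdonaldOp {n : ℕ} (l : ℕ) (I : Finset (Fin n)) (f : RatFun n) : RatFun n :=
  tVar n ^ l.choose 2 * ∑ J ∈ I.powersetCard l,
    resultant J (I \ J) (fun i => tVar n * xVar i) xVar / resultant J (I \ J) xVar xVar *
      qShift J f

/-- The creation operator `B_k^{(n)}`: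
`∑_{|I| = k} ∑_{l=0}^{k} (-t)^l x^I R(X_I, X_{I^c}/t) / R(X_I, X_{I^c}) M_l^{(I)}`. -/
def creationOp (n k : ℕ) (f : RatFun n) : RatFun n :=
  ∑ I ∈ (univ : Finset (Fin n)).powersetCard k, ∑ l ∈ range (k + 1),
    (-tVar n) ^ l * (∏ i ∈ I, xVar i) *
      (resultant I Iᶜ xVar (fun j => xVar j / tVar n) / resultant I Iᶜ xVar xVar) *
        macdonaldOp l I f

/-! ### Formal column operators on determinants of complete functions -/

/-- A `k × k` matrix of symbols `S_h[P]`, the symbol being recorded as the pair `(h, P)`. -/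
abbrev FormalMatrix (n k : ℕ) : Type := Matrix (Fin k) (Fin k) (ℤ × RatFun n)

/-- Formal linear combinations of `k × k` matrices of symbols. -/
abbrev FormalSum (n k : ℕ) : Type := FormalMatrix n k →₀ RatFun n

/-- The replacement `S_h[P] → S_{h + a_j}[P + b_j]` in every column `j`. -/
def shiftColumns {n k : ℕ} (a : Fin k → ℤ) (b : Fin k → RatFun n) (A : FormalMatrix n k) :
    FormalMatrix n k :=
  Matrix.of fun i j => ((A i j).1 + a j, (A i j).2 + b j)

/-- The formal column operator with top row `a` and bottom row `b`, extended linearly. -/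
def columnOp {n k : ℕ} (a : Fin k → ℤ) (b : Fin k → RatFun n) :
    Module.End (RatFun n) (FormalSum n k) :=
  Finsupp.lmapDomain (RatFun n) (RatFun n) (shiftColumns a b)

/-- The value of a formal linear combination: each matrix of symbols `S_h[P]` is replaced by
the determinant of the matrix of rational functions `S_h[P]`. -/
def evalDet {n k : ℕ} : FormalSum n k →ₗ[RatFun n] RatFun n :=
  Finsupp.linearCombination (RatFun n) fun A : FormalMatrix n k =>
    Matrix.det (Matrix.of fun i j => (complete (A i j).1).act (A i j).2)

/-- The `k × k` Jacobi–Trudi matrix of symbols for `S_μ[P]`, `μ` being padded by zeros. -/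
def jacobiTrudi {n : ℕ} (k : ℕ) (μ : YoungDiagram) (P : RatFun n) : FormalMatrix n k :=
  Matrix.of fun i j => ((μ.rowLen i : ℤ) - (i : ℕ) + (j : ℕ), P)

/-- The factor of column `i`: the column operator with `1` over `0` in column `i`, minus
`t^{k-i}` times the one with `1` over `X^t` in column `i` (columns numbered from `1` in the
exponent, from `0` in `Fin k`). -/
def columnFactor (n : ℕ) {k : ℕ} (i : Fin k) : Module.End (RatFun n) (FormalSum n k) :=
  columnOp (Pi.single i 1) 0
    - tVar n ^ (k - ((i : ℕ) + 1)) • columnOp (Pi.single i 1) (Pi.single i (Xt n))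

/-- The product of the column factors, `i = 1, …, k` from left to right. -/
def columnProduct (n k : ℕ) : Module.End (RatFun n) (FormalSum n k) :=
  (List.ofFn fun i : Fin k => columnFactor n i).prod

/-- `G_h(t^r) = S_h[Y + X] - t^r S_h[Y + X + X^t]`. -/
def G {n : ℕ} (Y : RatFun n) (h : ℤ) (r : ℕ) : RatFun n :=
  (complete h).act (Y + X n) - tVar n ^ r * (complete h).act (Y + X n + Xt n)

end CreationOperator

end

/-! Let σ(z) be the generating series of the S_h[X^{tq}]. Since Θ_J adds (t-1)∑_{j∈J} x_j to X^{tq}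
(`qShift_Xtq`), it turns σ into τ_J = σ ∏_{m∈J} (1 - x_m z)/(1 - t x_m z)
(`completeSeries_add_partialX`). So the left side is a combination, over J ⊆ I with |I| = k, of
determinants of coefficients of z^{a+1} τ_J. The determinant of the G's consists of coefficients of
z^a (σ - t^a τ_M), with M the set of all indices and a the reversed column index. The column
operators give that same determinant, because a determinant is linear in each column
(`evalDet_prod_columnFactor`).

Dividing by the common factor u = σ/∏_{m∈M} (1 - t x_m z) turns σ and all the τ_J into polynomials.
Row i of every determinant is then one linear functional p ↦ [z^{N_i}](u p) applied to a row of
polynomials. By Lagrange interpolation such functionals may be replaced by evaluations at distinct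
generic points z_i (`det_functional_eq_of_eval`). This leaves an identity of rational functions for
`twistDet`, the determinant of the z_i^a (L_M(t z_i) - t^a L_M(z_i)), where L_M(z) = ∏_{m∈M} (1 -
x_m z).

That identity has two halves: `twistDet_eq_sum` expands over the k-subsets I of M, which yields the
resultants of X_I against its complement; `twistDet_eq_splitSum` evaluates the case |I| = k as a
Vandermonde determinant times the sum over J ⊆ I that defines the Macdonald operators. Both go by
induction on k: as polynomials in the first variable w, the two sides agree at more points than
their degree. At w = 1/x_m or w = 1/(t x_m) the first row becomes geometric and the determinant
drops to size k - 1 with m removed (`det_cons_pow`). -/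

namespace CreationOperator

open Finset

/-! ### Functions given by polynomials of bounded degree -/

section PolynomialFunctions

variable {F : Type*} [Field F]

/-- The function `f` is given by a polynomial of degree at most `d`. -/
def IsPolyDegLE (d : ℕ) (f : F → F) : Prop :=
  ∃ P : Polynomial F, P.natDegree ≤ d ∧ ∀ z, P.eval z = f z

theorem IsPolyDegLE.mono {d e : ℕ} {f : F → F} (h : IsPolyDegLE d f) (hde : d ≤ e) :
    IsPolyDegLE e f := by
  obtain ⟨P, hP, hf⟩ := h
  exact ⟨P, hP.trans hde, hf⟩

theorem isPolyDegLE_const (c : F) : IsPolyDegLE 0 (fun _ => c) :=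
  ⟨Polynomial.C c, by simp, by simp⟩

theorem isPolyDegLE_id : IsPolyDegLE 1 (fun z : F => z) :=
  ⟨Polynomial.X, by simp, by simp⟩

theorem IsPolyDegLE.mul {d e : ℕ} {f g : F → F} (hf : IsPolyDegLE d f) (hg : IsPolyDegLE e g) :
    IsPolyDegLE (d + e) (fun z => f z * g z) := by
  obtain ⟨P, hP, hf⟩ := hf
  obtain ⟨Q, hQ, hg⟩ := hg
  exact ⟨P * Q, Polynomial.natDegree_mul_le_of_le hP hQ, fun z => by simp [hf, hg]⟩

theorem IsPolyDegLE.const_mul {d : ℕ} {f : F → F} (hf : IsPolyDegLE d f) (c : F) :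
    IsPolyDegLE d (fun z => c * f z) :=
  ((isPolyDegLE_const c).mul hf).mono (by simp)

theorem IsPolyDegLE.sub {d : ℕ} {f g : F → F} (hf : IsPolyDegLE d f) (hg : IsPolyDegLE d g) :
    IsPolyDegLE d (fun z => f z - g z) := by
  obtain ⟨P, hP, hf⟩ := hf
  obtain ⟨Q, hQ, hg⟩ := hg
  exact ⟨P - Q, Polynomial.natDegree_sub_le_of_le hP hQ |>.trans (by simp),
    fun z => by simp [hf, hg]⟩

theorem IsPolyDegLE.sum {κ : Type*} {d : ℕ} (s : Finset κ) {f : κ → F → F}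
    (hf : ∀ i ∈ s, IsPolyDegLE d (f i)) : IsPolyDegLE d (fun z => ∑ i ∈ s, f i z) := by
  classical
  choose! P hP hPf using hf
  refine ⟨∑ i ∈ s, P i, Polynomial.natDegree_sum_le_of_forall_le _ _ hP, fun z => ?_⟩
  rw [Polynomial.eval_finsetSum]
  exact Finset.sum_congr rfl fun i hi => hPf i hi z

theorem isPolyDegLE_pow (a : ℕ) : IsPolyDegLE a (fun z : F => z ^ a) :=
  ⟨Polynomial.X ^ a, by simp, by simp⟩

theorem IsPolyDegLE.prod {κ : Type*} (s : Finset κ) {f : κ → F → F}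
    (hf : ∀ i ∈ s, IsPolyDegLE 1 (f i)) : IsPolyDegLE #s (fun z => ∏ i ∈ s, f i z) := by
  classical
  choose! P hP hPf using hf
  refine ⟨∏ i ∈ s, P i, (Polynomial.natDegree_prod_le _ _).trans
    ((Finset.sum_le_card_nsmul _ _ 1 hP).trans (by simp)), fun z => ?_⟩
  rw [Polynomial.eval_prod]
  exact Finset.prod_congr rfl fun i hi => hPf i hi z

/-- The interpolation principle behind both inductions. It gives equality of functions everywhere,
so the variable that is moved needs no genericity. -/
theorem IsPolyDegLE.eq_of_eqOn {d : ℕ} {f g : F → F} (hf : IsPolyDegLE d f)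
    (hg : IsPolyDegLE d g) (s : Finset F) (hs : d < #s) (h : ∀ z ∈ s, f z = g z) : f = g := by
  obtain ⟨P, hP, hf⟩ := hf
  obtain ⟨Q, hQ, hg⟩ := hg
  have hPQ : P = Q := Polynomial.eq_of_natDegree_lt_card_of_eval_eq' P Q s
    (fun z hz => by rw [hf, hg, h z hz]) (by omega)
  funext z
  rw [← hf, ← hg, hPQ]

end PolynomialFunctions

/-! ### Twisted Vandermonde determinants -/

section TwistedVandermonde

variable {F : Type*} [Field F] {ι : Type*}

/-- The product `∏_{m ∈ M} (1 - x_m z)`. -/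
def linProd (x : ι → F) (M : Finset ι) (z : F) : F := ∏ m ∈ M, (1 - x m * z)

/-- The determinant of the `z_i ^ a (∏ (1 - t x_m z_i) - t ^ a ∏ (1 - x_m z_i))`. -/
def twistDet (x : ι → F) (t : F) (M : Finset ι) {k : ℕ} (z : Fin k → F) : F :=
  Matrix.det (Matrix.of fun i a : Fin k =>
    z i ^ (a : ℕ) * (linProd x M (t * z i) - t ^ (a : ℕ) * linProd x M (z i)))

theorem linProd_zero (x : ι → F) (M : Finset ι) : linProd x M 0 = 1 := by simp [linProd]

theorem linProd_insert [DecidableEq ι] (x : ι → F) {M : Finset ι} {m : ι} (hm : m ∉ M) (z : F) :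
    linProd x (insert m M) z = (1 - x m * z) * linProd x M z := prod_insert hm

theorem linProd_eq_zero (x : ι → F) {M : Finset ι} {m : ι} (hm : m ∈ M) {z : F}
    (h : x m * z = 1) : linProd x M z = 0 :=
  prod_eq_zero hm (by simp [h])

theorem isPolyDegLE_linProd (x : ι → F) (M : Finset ι) : IsPolyDegLE #M (linProd x M) :=
  IsPolyDegLE.prod M fun m _ =>
    ((isPolyDegLE_const (1 : F)).mono zero_le_one).sub (isPolyDegLE_id.const_mul (x m))

theorem isPolyDegLE_linProd_mul (x : ι → F) (t : F) (M : Finset ι) :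
    IsPolyDegLE #M (fun z => linProd x M (t * z)) :=
  IsPolyDegLE.prod M fun m _ => by
    simpa only [mul_assoc] using
      ((isPolyDegLE_const (1 : F)).mono zero_le_one).sub (isPolyDegLE_id.const_mul (x m * t))

/-- A first row 1, y, y², … is cleared by subtracting y times each column from the next. With y =
1/x_m, the factors z - y and tz - y are multiples of 1 - x_m z and 1 - t x_m z. These supply the
factor of m missing from each of the two terms, so the remaining rows are those for M, up to
scalars. -/
theorem det_cons_pow [DecidableEq ι] (x : ι → F) (t : F) {M : Finset ι} {m : ι} (hm : m ∉ M)
    {y : F} (hy : x m * y = 1) {k : ℕ} (z : Fin k → F) :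
    Matrix.det (Matrix.of (Fin.cons (fun a : Fin (k + 1) => y ^ (a : ℕ)) fun i a =>
        z i ^ (a : ℕ) * (linProd x (insert m M) (t * z i) -
          t ^ (a : ℕ) * linProd x (insert m M) (z i))) : Matrix (Fin (k + 1)) (Fin (k + 1)) F) =
      (∏ i, (-y) * (1 - x m * z i) * (1 - x m * (t * z i))) * twistDet x t M z := by
  set A : Matrix (Fin (k + 1)) (Fin (k + 1)) F :=
    Matrix.of (Fin.cons (fun a : Fin (k + 1) => y ^ (a : ℕ)) fun i a =>
        z i ^ (a : ℕ) * (linProd x (insert m M) (t * z i) -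
          t ^ (a : ℕ) * linProd x (insert m M) (z i))) with hA
  -- Column j + 1 of `A` minus y times column j; the first row becomes (1, 0, …, 0).
  let B : Matrix (Fin (k + 1)) (Fin (k + 1)) F := Matrix.of fun i =>
    Fin.cons (A i 0) fun j => A i j.succ - y * A i j.castSucc
  have hAB : A.det = B.det :=
    Matrix.det_eq_of_forall_col_eq_smul_add_pred (fun _ => y) (fun i => by simp [B])
      (fun i j => by simp [B])
  have hB0 : B 0 0 = 1 := by simp [B, A]
  have hB : ∀ j : Fin k, B 0 j.succ = 0 := fun j => by simp [B, A, pow_succ']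
  have hBs : ∀ i j : Fin k, B i.succ j.succ =
      ((-y) * (1 - x m * z i) * (1 - x m * (t * z i))) *
        (z i ^ (j : ℕ) * (linProd x M (t * z i) - t ^ (j : ℕ) * linProd x M (z i))) := fun i j => by
    simp only [B, A, Matrix.of_apply, Fin.cons_succ, Fin.val_succ, Fin.val_castSucc,
      linProd_insert x hm, pow_succ]
    linear_combination (-1 : F) * (t ^ (j : ℕ) * z i ^ (j : ℕ) * z i * t * linProd x M (z i) * (x m * z i - 1)
      - z i ^ (j : ℕ) * z i * linProd x M (t * z i) * (x m * (t * z i) - 1)) * hy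
  rw [hAB, Matrix.det_succ_row_zero, Fin.sum_univ_succ]
  simp only [hB0, hB, Fin.succAbove_zero, mul_zero, zero_mul, sum_const_zero, add_zero,
    Fin.val_zero, pow_zero, one_mul]
  rw [twistDet, ← Matrix.det_mul_column]
  congr 1
  ext i j
  exact hBs i j

theorem twistDet_cons (x : ι → F) (t : F) (M : Finset ι) {k : ℕ} (w : F) (z : Fin k → F) :
    twistDet x t M (Fin.cons w z : Fin (k + 1) → F) =
      Matrix.det (Matrix.of (Fin.cons (fun a : Fin (k + 1) =>
          w ^ (a : ℕ) * (linProd x M (t * w) - t ^ (a : ℕ) * linProd x M w)) fun i a =>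
        z i ^ (a : ℕ) * (linProd x M (t * z i) - t ^ (a : ℕ) * linProd x M (z i))) :
          Matrix (Fin (k + 1)) (Fin (k + 1)) F) := by
  rw [twistDet]
  congr 1
  ext i j
  refine Fin.cases ?_ (fun i => ?_) i <;> simp

theorem det_cons_smul {k : ℕ} (c : F) (r : Fin (k + 1) → F) (A : Fin k → Fin (k + 1) → F) :
    Matrix.det (Matrix.of (Fin.cons (fun a => c * r a) A) : Matrix (Fin (k + 1)) (Fin (k + 1)) F) =
      c * Matrix.det (Matrix.of (Fin.cons r A) : Matrix (Fin (k + 1)) (Fin (k + 1)) F) := by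
  rw [Matrix.det_succ_row_zero, Matrix.det_succ_row_zero, mul_sum]
  refine sum_congr rfl fun j _ => ?_
  have : ∀ r : Fin (k + 1) → F,
      (Matrix.of (Fin.cons r A) : Matrix (Fin (k + 1)) (Fin (k + 1)) F).submatrix Fin.succ
        j.succAbove = Matrix.of fun i a => A i (j.succAbove a) := fun r => by
    ext; simp
  rw [this, this]
  simp
  ring

/-- At y = 1/x_m the term carrying t^a vanishes from the first row, which is then proportional to
the powers of y. -/
theorem twistDet_cons_inv [DecidableEq ι] (x : ι → F) (t : F) {M : Finset ι} {m : ι} (hm : m ∉ M)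
    {y : F} (hy : x m * y = 1) {k : ℕ} (z : Fin k → F) :
    twistDet x t (insert m M) (Fin.cons y z : Fin (k + 1) → F) =
      linProd x (insert m M) (t * y) *
        ((∏ i, (-y) * (1 - x m * z i) * (1 - x m * (t * z i))) * twistDet x t M z) := by
  rw [← det_cons_pow x t hm hy, ← det_cons_smul, twistDet_cons,
    linProd_eq_zero x (mem_insert_self m M) hy]
  simp only [mul_zero, sub_zero, mul_comm]

/-- At y = 1/(t x_m) the other term vanishes, and the first row is proportional to the powers of ty
= 1/x_m. -/
theorem twistDet_cons_inv_mul [DecidableEq ι] (x : ι → F) (t : F) {M : Finset ι} {m : ι}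
    (hm : m ∉ M) {y : F} (hy : x m * (t * y) = 1) {k : ℕ} (z : Fin k → F) :
    twistDet x t (insert m M) (Fin.cons y z : Fin (k + 1) → F) =
      -linProd x (insert m M) y *
        ((∏ i, (-(t * y)) * (1 - x m * z i) * (1 - x m * (t * z i))) * twistDet x t M z) := by
  rw [← det_cons_pow x t hm hy, ← det_cons_smul, twistDet_cons,
    linProd_eq_zero x (mem_insert_self m M) hy]
  congr 3
  funext a
  rw [mul_pow]
  ring

/-- For a > 0 the power of w vanishes; for a = 0 the difference is 1 - 1. -/
theorem twistDet_cons_zero (x : ι → F) (t : F) (M : Finset ι) {k : ℕ} (z : Fin k → F) :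
    twistDet x t M (Fin.cons 0 z : Fin (k + 1) → F) = 0 := by
  refine Matrix.det_eq_zero_of_row_eq_zero 0 fun a => ?_
  refine Fin.cases ?_ (fun a => ?_) a <;> simp [linProd_zero]

theorem twistDet_eq_zero (x : ι → F) (t : F) (M : Finset ι) {k : ℕ} {z : Fin k → F} {i j : Fin k}
    (hij : i ≠ j) (h : z i = z j) : twistDet x t M z = 0 :=
  Matrix.det_zero_of_row_eq hij (by funext a; simp [h])

/-- Only the first row involves w, and its entries have degree at most a + #M with a ≤ k. -/
theorem isPolyDegLE_twistDet (x : ι → F) (t : F) (M : Finset ι) {k : ℕ} (z : Fin k → F) :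
    IsPolyDegLE (#M + k) (fun w => twistDet x t M (Fin.cons w z : Fin (k + 1) → F)) := by
  simp only [twistDet_cons, Matrix.det_succ_row_zero]
  refine IsPolyDegLE.sum _ fun a _ => ?_
  have h : IsPolyDegLE (#M + k) fun w => w ^ (a : ℕ) *
      (linProd x M (t * w) - t ^ (a : ℕ) * linProd x M w) :=
    ((isPolyDegLE_pow (a : ℕ)).mul ((isPolyDegLE_linProd_mul x t M).sub
      ((isPolyDegLE_linProd x M).const_mul _))).mono (by omega)
  convert h.const_mul ((-1) ^ (a : ℕ) * (Matrix.of fun i b =>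
    z i ^ (a.succAbove b : ℕ) * (linProd x M (t * z i) -
      t ^ (a.succAbove b : ℕ) * linProd x M (z i))).det) using 2 with w
  have hs : (Matrix.of (Fin.cons (fun a : Fin (k + 1) =>
          w ^ (a : ℕ) * (linProd x M (t * w) - t ^ (a : ℕ) * linProd x M w)) fun i a =>
        z i ^ (a : ℕ) * (linProd x M (t * z i) - t ^ (a : ℕ) * linProd x M (z i))) :
          Matrix (Fin (k + 1)) (Fin (k + 1)) F).submatrix Fin.succ a.succAbove = Matrix.of fun i b =>
    z i ^ (a.succAbove b : ℕ) * (linProd x M (t * z i) -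
      t ^ (a.succAbove b : ℕ) * linProd x M (z i)) := by
    ext; simp
  rw [hs]
  simp only [Matrix.of_apply, Fin.cons_zero]
  ring

end TwistedVandermonde

/-! ### Expansion of the twisted determinant over k-subsets, and its evaluation on a set of size k
-/

section TwistedVandermonde

variable {F : Type*} [Field F] {ι : Type*}

theorem linProd_sdiff_mul [DecidableEq ι] (x : ι → F) {I M : Finset ι} (h : I ⊆ M) (z : F) :
    linProd x M z = linProd x (M \ I) z * linProd x I z :=
  (prod_sdiff h).symm

theorem twistDet_eq_sum [DecidableEq ι] {x : ι → F} {t : F} (hx : Function.Injective x)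
    (hx0 : ∀ m, x m ≠ 0) (ht : t ≠ 0) {k : ℕ} (M : Finset ι) (z : Fin k → F)
    (hz : Function.Injective z) (hz0 : ∀ i, z i ≠ 0) (hxz : ∀ m ∈ M, ∀ i, x m * (t * z i) ≠ 1) :
    twistDet x t M z = ∑ I ∈ powersetCard k M,
      (∏ i ∈ I, ∏ j ∈ M \ I, (x i - x j / t) / (x i - x j)) *
        (∏ i, linProd x (M \ I) (t * z i)) * twistDet x t I z := by
  have := Classical.decEq F
  induction k generalizing M with
  | zero => simp [twistDet]
  | succ k ih =>
    obtain ⟨w, z, rfl⟩ : ∃ w z', z = (Fin.cons w z' : Fin (k + 1) → F) :=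
      ⟨z 0, Fin.tail z, (Fin.cons_self_tail z).symm⟩
    have hz' : Function.Injective z := (Fin.cons_injective_iff.1 hz).2
    have hz0' : ∀ i, z i ≠ 0 := fun i => by simpa using hz0 i.succ
    have hxz' : ∀ m ∈ M, ∀ i, x m * (t * z i) ≠ 1 := fun m hm i => by simpa using hxz m hm i.succ
    -- Both sides have degree at most #M + k in w and are compared at #M + k + 1 nodes: 0, the
    -- remaining z_i, and the 1/(x_m t). The genericity hypotheses make these nodes distinct.
    refine congrFun (IsPolyDegLE.eq_of_eqOn (g := fun w => ∑ I ∈ powersetCard (k + 1) M,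
      (∏ i ∈ I, ∏ j ∈ M \ I, (x i - x j / t) / (x i - x j)) *
        (∏ i, linProd x (M \ I) (t * (Fin.cons w z : Fin (k + 1) → F) i)) *
          twistDet x t I (Fin.cons w z : Fin (k + 1) → F))
      (isPolyDegLE_twistDet x t M z) (IsPolyDegLE.sum _ fun I hI => ?_)
      (insert 0 (univ.image z ∪ M.image fun m => (x m * t)⁻¹)) ?_ ?_) w
    · rw [mem_powersetCard] at hI
      simp only [Fin.prod_univ_succ, Fin.cons_zero, Fin.cons_succ]
      have h := ((((isPolyDegLE_linProd_mul x t (M \ I)).mul (isPolyDegLE_twistDet x t I z))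
        ).const_mul ((∏ i ∈ I, ∏ j ∈ M \ I, (x i - x j / t) / (x i - x j)) *
          ∏ i, linProd x (M \ I) (t * z i))).mono (e := #M + k)
          (by have := card_sdiff_add_card_eq_card hI.1; omega)
      convert h using 2
      ring
    · rw [card_insert_of_notMem, card_union_of_disjoint, card_image_of_injective _ hz',
        card_image_of_injective]
      · simp; omega
      · intro a b hab
        exact hx (mul_right_cancel₀ ht (inv_injective hab))
      · rw [disjoint_left]
        intro c hc hc'
        obtain ⟨i, -, rfl⟩ := mem_image.1 hc
        obtain ⟨m, hm, hmi⟩ := mem_image.1 hc'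
        refine hxz' m hm i ?_
        rw [← hmi]
        field_simp [hx0 m]
      · simp only [mem_union, mem_image, mem_univ, true_and, not_or, not_exists, not_and]
        exact ⟨fun i => hz0' i, fun m _ => inv_ne_zero (mul_ne_zero (hx0 m) ht)⟩
    · intro c hc
      rw [mem_insert, mem_union, mem_image, mem_image] at hc
      rcases hc with rfl | ⟨i, -, rfl⟩ | ⟨m, hm, rfl⟩
      · simp [twistDet_cons_zero]
      · have h0 : ∀ M : Finset ι,
            twistDet x t M (Fin.cons (z i) z : Fin (k + 1) → F) = 0 := fun M =>
          twistDet_eq_zero x t M (Fin.succ_ne_zero i).symm (by simp)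
        simp [h0]
      · obtain ⟨M, hmM, rfl⟩ : ∃ M', m ∉ M' ∧ M = insert m M' :=
          ⟨M.erase m, notMem_erase m M, (insert_erase hm).symm⟩
        have hy : x m * (t * (x m * t)⁻¹) = 1 := by field_simp [hx0 m]
        set y := (x m * t)⁻¹ with hydef
        -- At w = 1/(x_m t) only the I containing m survive, since otherwise `linProd` over the
        -- complement of I vanishes at tw.
        rw [twistDet_cons_inv_mul x t hmM hy, ih M z hz' hz0'
          (fun j hj => hxz' j (mem_insert_of_mem hj)), powersetCard_succ_insert hmM, sum_union,
          sum_image, sum_eq_zero (s := powersetCard k.succ M), zero_add, mul_sum, mul_sum]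
        · refine sum_congr rfl fun I hI => ?_
          rw [mem_powersetCard] at hI
          have hmI : m ∉ I := fun h => hmM (hI.1 h)
          have hsd : insert m M \ insert m I = M \ I := by
            rw [insert_sdiff_insert, sdiff_insert_of_notMem hmM]
          rw [hsd, prod_insert hmI, twistDet_cons_inv_mul x t hmI hy, Fin.prod_univ_succ]
          -- Passing from ty to y produces exactly the new resultant factors of m against the
          -- complement of I.
          have h1 : linProd x (M \ I) y = (∏ j ∈ M \ I, (x m - x j / t) / (x m - x j)) *
              linProd x (M \ I) (t * y) := by
            rw [linProd, linProd, ← prod_mul_distrib]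
            refine prod_congr rfl fun j hj => ?_
            have hmj : x m - x j ≠ 0 := sub_ne_zero.2 fun h => by
              rw [← hx h] at hj
              exact hmM (mem_sdiff.1 hj).1
            rw [hydef]
            field_simp [hx0 m]
          have h2 : linProd x (insert m M) y = (∏ j ∈ M \ I, (x m - x j / t) / (x m - x j)) *
              linProd x (M \ I) (t * y) * linProd x (insert m I) y := by
            rw [← h1, linProd_sdiff_mul x (insert_subset_insert m hI.1), hsd]
          rw [h2]
          simp only [Fin.cons_zero, Fin.cons_succ]
          ring
        · intro I hI
          rw [mem_powersetCard] at hI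
          have : m ∈ insert m M \ I := mem_sdiff.2 ⟨mem_insert_self m M, fun h => hmM (hI.1 h)⟩
          rw [Fin.prod_univ_succ, Fin.cons_zero, linProd_eq_zero x this hy]
          simp
        · intro I hI I' hI' h
          rw [mem_coe, mem_powersetCard] at hI hI'
          rw [← erase_insert (fun h' => hmM (hI.1 h')), h, erase_insert fun h' => hmM (hI'.1 h')]
        · rw [disjoint_left]
          intro I hI hI'
          obtain ⟨J, -, rfl⟩ := mem_image.1 hI'
          exact hmM ((mem_powersetCard.1 hI).1 (mem_insert_self m J))

/-- The sum over `J ⊆ I` of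
`(-t) ^ |J| t ^ (|J| choose 2) ∏_{i ∈ J, j ∈ I ∖ J} (t x_i - x_j) / (x_i - x_j)` times
`∏_i ∏_{m ∈ J} (1 - x_m z_i) ∏_{m ∈ I ∖ J} (1 - t x_m z_i)`. -/
def splitSum [DecidableEq ι] (x : ι → F) (t : F) (I : Finset ι) {k : ℕ} (z : Fin k → F) : F :=
  ∑ J ∈ I.powerset, (-t) ^ #J * t ^ (#J).choose 2 *
    (∏ i ∈ J, ∏ j ∈ I \ J, (t * x i - x j) / (x i - x j)) *
      ∏ i, (linProd x J (z i) * linProd x (I \ J) (t * z i))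

theorem det_vandermonde_cons {k : ℕ} (w : F) (z : Fin k → F) :
    (Matrix.vandermonde (Fin.cons w z : Fin (k + 1) → F)).det =
      (∏ i, (z i - w)) * (Matrix.vandermonde z).det := by
  rw [Matrix.det_vandermonde, Matrix.det_vandermonde, Fin.prod_univ_succ, Fin.prod_Ioi_zero]
  simp

/-- At y = 1/x_m the subsets J containing m contribute 0. In the others, the cross factors between J
and m turn `linProd` over J at y into its value at ty, so a factor independent of J comes out. -/
theorem splitSum_cons_inv [DecidableEq ι] {x : ι → F} (hx : Function.Injective x) (t : F)
    {I : Finset ι} {m : ι} (hm : m ∉ I) {y : F} (hy : x m * y = 1) {k : ℕ} (z : Fin k → F) :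
    splitSum x t (insert m I) (Fin.cons y z : Fin (k + 1) → F) =
      linProd x (insert m I) (t * y) * (∏ i, (1 - x m * (t * z i))) * splitSum x t I z := by
  have hxm : x m ≠ 0 := left_ne_zero_of_mul_eq_one hy
  have hy' : y = (x m)⁻¹ := eq_inv_of_mul_eq_one_right hy
  rw [splitSum, sum_powerset_insert hm, sum_eq_zero (s := I.powerset) (f := fun J => (-t) ^
    #(insert m J) * _ * _ * _), add_zero, splitSum, mul_sum]
  · refine sum_congr rfl fun J hJ => ?_
    rw [mem_powerset] at hJ
    have hmJ : m ∉ J := fun h => hm (hJ h)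
    have hmIJ : m ∉ I \ J := fun h => hm (mem_sdiff.1 h).1
    rw [insert_sdiff_of_notMem _ hmJ, Fin.prod_univ_succ]
    simp only [prod_insert hmIJ, Fin.cons_zero, Fin.cons_succ, prod_mul_distrib,
      linProd_insert x hmIJ]
    have h : (∏ i ∈ J, (t * x i - x m) / (x i - x m)) * linProd x J y = linProd x J (t * y) := by
      rw [linProd, linProd, ← prod_mul_distrib]
      refine prod_congr rfl fun i hi => ?_
      have him : x i - x m ≠ 0 := sub_ne_zero.2 fun h => hmJ (by rwa [← hx h])
      rw [hy']
      field_simp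
      ring
    rw [linProd_insert x hm, linProd_sdiff_mul x hJ (t * y), ← h]
    ring
  · intro J _
    rw [Fin.prod_univ_succ, Fin.cons_zero, linProd_eq_zero x (mem_insert_self m J) hy]
    simp

/-- At y = 1/(t x_m) only the subsets containing m contribute. The power of t does not depend on J:
the binomial exponent grows by #J, and the cross factors between m and I \ J give t^#(I \ J). -/
theorem splitSum_cons_inv_mul [DecidableEq ι] {x : ι → F} (hx : Function.Injective x) (t : F)
    {I : Finset ι} {m : ι} (hm : m ∉ I) {y : F} (hy : x m * (t * y) = 1) {k : ℕ}
    (z : Fin k → F) :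
    splitSum x t (insert m I) (Fin.cons y z : Fin (k + 1) → F) =
      (-t) * t ^ #I * linProd x (insert m I) y * (∏ i, (1 - x m * z i)) * splitSum x t I z := by
  have hxm : x m ≠ 0 := left_ne_zero_of_mul_eq_one hy
  have ht : t ≠ 0 := left_ne_zero_of_mul (right_ne_zero_of_mul_eq_one hy)
  have hy' : y = (x m * t)⁻¹ := eq_inv_of_mul_eq_one_right (by rw [← hy]; ring)
  rw [splitSum, sum_powerset_insert hm, sum_eq_zero (s := I.powerset), zero_add, splitSum, mul_sum]
  · refine sum_congr rfl fun J hJ => ?_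
    rw [mem_powerset] at hJ
    have hmJ : m ∉ J := fun h => hm (hJ h)
    have hsd : insert m I \ insert m J = I \ J := by
      rw [insert_sdiff_insert, sdiff_insert_of_notMem hm]
    rw [hsd, Fin.prod_univ_succ, prod_insert hmJ, card_insert_of_notMem hmJ]
    simp only [Fin.cons_zero, Fin.cons_succ, prod_mul_distrib, linProd_insert x hmJ]
    have h : (∏ j ∈ I \ J, (t * x m - x j) / (x m - x j)) * linProd x (I \ J) (t * y) =
        t ^ #(I \ J) * linProd x (I \ J) y := by
      rw [linProd, linProd, ← prod_mul_distrib, ← prod_const, ← prod_mul_distrib]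
      refine prod_congr rfl fun j hj => ?_
      have hmj : x m - x j ≠ 0 := sub_ne_zero.2 fun h => by
        rw [← hx h] at hj
        exact hm (mem_sdiff.1 hj).1
      rw [hy']
      field_simp
    have hch : (#J + 1).choose 2 = #J + (#J).choose 2 := by
      rw [Nat.choose_succ_succ' _ 1, Nat.choose_one_right]
    rw [linProd_insert x hm, linProd_sdiff_mul x hJ y, hch, ← card_sdiff_add_card_eq_card hJ]
    linear_combination (-t) ^ (#J + 1) * t ^ (#J + (#J).choose 2) *
      (∏ i ∈ J, ∏ j ∈ I \ J, (t * x i - x j) / (x i - x j)) * (1 - x m * y) * linProd x J y *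
      ((∏ i, (1 - x m * z i)) * (∏ i, linProd x J (z i))) *
      (∏ i, linProd x (I \ J) (t * z i)) * h
  · intro J hJ
    have : m ∈ insert m I \ J :=
      mem_sdiff.2 ⟨mem_insert_self m I, fun h => hm (mem_powerset.1 hJ h)⟩
    rw [Fin.prod_univ_succ, Fin.cons_zero, linProd_eq_zero x this hy]
    simp

theorem twistDet_eq_splitSum [DecidableEq ι] {x : ι → F} {t : F} (hx : Function.Injective x)
    (hx0 : ∀ m, x m ≠ 0) (ht : t ≠ 0) (hxt : ∀ i j, x i ≠ x j * t) {k : ℕ} (I : Finset ι)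
    (hI : #I = k) (z : Fin k → F) :
    twistDet x t I z = (∏ i ∈ I, x i) * (∏ i, z i) * (Matrix.vandermonde z).det *
      splitSum x t I z := by
  have := Classical.decEq F
  induction k generalizing I with
  | zero =>
    rw [card_eq_zero] at hI
    subst hI
    simp [twistDet, splitSum]
  | succ k ih =>
    obtain ⟨w, z, rfl⟩ : ∃ w z', z = (Fin.cons w z' : Fin (k + 1) → F) :=
      ⟨z 0, Fin.tail z, (Fin.cons_self_tail z).symm⟩
    -- On the right, the degree is 1 from w, k from the Vandermonde determinant and k + 1 from each
    -- summand of `splitSum`. The nodes 0, 1/x_m and 1/(x_m t) number 2k + 3.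
    refine congrFun (IsPolyDegLE.eq_of_eqOn (d := 2 * k + 2)
      (g := fun w => (∏ i ∈ I, x i) * (∏ i, (Fin.cons w z : Fin (k + 1) → F) i) *
        (Matrix.vandermonde (Fin.cons w z : Fin (k + 1) → F)).det *
          splitSum x t I (Fin.cons w z : Fin (k + 1) → F))
      ((isPolyDegLE_twistDet x t I z).mono (by omega)) ?_
      (insert 0 (I.image (fun m => (x m)⁻¹) ∪ I.image fun m => (x m * t)⁻¹)) ?_ ?_) w
    · simp only [Fin.prod_univ_succ, Fin.cons_zero, Fin.cons_succ, det_vandermonde_cons, splitSum,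
        mul_sum]
      refine IsPolyDegLE.sum _ fun J hJ => ?_
      have h1 : IsPolyDegLE k fun w => ∏ i, (z i - w) := by
        simpa using IsPolyDegLE.prod univ fun i _ =>
          ((isPolyDegLE_const (z i)).mono zero_le_one).sub isPolyDegLE_id
      have h2 := (isPolyDegLE_linProd x J).mul (isPolyDegLE_linProd_mul x t (I \ J))
      have h := (((isPolyDegLE_id (F := F)).mul (h1.mul h2)).const_mul ((∏ i ∈ I, x i) *
        (∏ i, z i) * (Matrix.vandermonde z).det * ((-t) ^ #J * t ^ (#J).choose 2 *
          (∏ i ∈ J, ∏ j ∈ I \ J, (t * x i - x j) / (x i - x j)) *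
            ∏ i, (linProd x J (z i) * linProd x (I \ J) (t * z i))))).mono (e := 2 * k + 2)
          (by have := card_sdiff_add_card_eq_card (mem_powerset.1 hJ); omega)
      convert h using 2
      ring
    · rw [card_insert_of_notMem, card_union_of_disjoint, card_image_of_injective,
        card_image_of_injective]
      · omega
      · exact fun a b hab => hx (mul_right_cancel₀ ht (inv_injective hab))
      · exact fun a b hab => hx (inv_injective hab)
      · rw [disjoint_left]
        intro c hc hc'
        obtain ⟨i, -, rfl⟩ := mem_image.1 hc
        obtain ⟨m, -, hmi⟩ := mem_image.1 hc'
        exact hxt i m (inv_injective hmi).symm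
      · simp only [mem_union, mem_image, not_or, not_exists, not_and]
        exact ⟨fun m _ => inv_ne_zero (hx0 m), fun m _ => inv_ne_zero (mul_ne_zero (hx0 m) ht)⟩
    · intro c hc
      rw [mem_insert, mem_union, mem_image, mem_image] at hc
      rcases hc with rfl | ⟨m, hm, rfl⟩ | ⟨m, hm, rfl⟩
      · simp [twistDet_cons_zero, Fin.prod_univ_succ]
      all_goals
        obtain ⟨I, hmI, rfl⟩ : ∃ I', m ∉ I' ∧ I = insert m I' :=
          ⟨I.erase m, notMem_erase m I, (insert_erase hm).symm⟩
        rw [card_insert_of_notMem hmI, Nat.add_right_cancel_iff] at hI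
      · have hy : x m * (x m)⁻¹ = 1 := mul_inv_cancel₀ (hx0 m)
        set y := (x m)⁻¹
        rw [twistDet_cons_inv x t hmI hy, ih I hI z, splitSum_cons_inv hx t hmI hy,
          prod_insert hmI, det_vandermonde_cons, Fin.prod_univ_succ]
        simp only [Fin.cons_zero, Fin.cons_succ, prod_mul_distrib]
        have h : ∏ i, (z i - y) = (∏ i : Fin k, (-y)) * ∏ i, (1 - x m * z i) := by
          rw [← prod_mul_distrib]
          exact prod_congr rfl fun i _ => by linear_combination (-z i) * hy
        rw [h]
        linear_combination (-1 : F) * (linProd x (insert m I) (t * y) * ((∏ i : Fin k, (-y)) *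
          (∏ i, (1 - x m * z i)) * (∏ i, (1 - x m * (t * z i))) * ((∏ i ∈ I, x i) * (∏ i, z i) *
          (Matrix.vandermonde z).det * splitSum x t I z))) * hy
      · have hy : x m * (t * (x m * t)⁻¹) = 1 := by field_simp [hx0 m]
        set y := (x m * t)⁻¹
        rw [twistDet_cons_inv_mul x t hmI hy, ih I hI z, splitSum_cons_inv_mul hx t hmI hy,
          prod_insert hmI, det_vandermonde_cons, Fin.prod_univ_succ, hI]
        simp only [Fin.cons_zero, Fin.cons_succ, prod_mul_distrib]
        have h : t ^ k * ∏ i, (z i - y) =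
            (∏ i : Fin k, (-(t * y))) * ∏ i, (1 - x m * (t * z i)) := by
          rw [← prod_mul_distrib, ← Fin.prod_const, ← prod_mul_distrib]
          exact prod_congr rfl fun i _ => by linear_combination (-t * z i) * hy
        linear_combination (-1 : F) * (linProd x (insert m I) y * (∏ i, (1 - x m * z i)) *
          ((∏ i ∈ I, x i) * (∏ i, z i) * (Matrix.vandermonde z).det * splitSum x t I z)) *
          ((-(x m * (t * y))) * h - (∏ i : Fin k, (-(t * y))) *
            (∏ i, (1 - x m * (t * z i))) * hy)

end TwistedVandermonde

/-! ### From evaluations at points to arbitrary linear functionals -/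

section Functionals

variable {F : Type*} [Field F]

theorem linearMap_eq_sum_lagrange [DecidableEq F] (T : Finset F) (φ : Polynomial F →ₗ[F] F)
    {f : Polynomial F} (hf : f.degree < #T) :
    φ f = ∑ p : T, φ (Lagrange.basis T id (p : F)) * f.eval (p : F) := by
  conv_lhs => rw [Lagrange.eq_interpolate (v := id) (Set.injOn_id _) hf]
  rw [Lagrange.interpolate_apply, map_sum, ← sum_coe_sort]
  refine sum_congr rfl fun p _ => ?_
  rw [← Polynomial.smul_eq_C_mul, map_smul, smul_eq_mul, mul_comm, id]

/-- On polynomials of degree below #T each functional is a combination of evaluations at the points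
of T; the determinant is then expanded by linearity in the rows. -/
theorem det_functional_eq_sum [DecidableEq F] {k : ℕ} (T : Finset F)
    (φ : Fin k → Polynomial F →ₗ[F] F) (f : Fin k → Polynomial F) (hf : ∀ j, (f j).degree < #T) :
    Matrix.det (Matrix.of fun i j => φ i (f j)) =
      ∑ r : Fin k → T, (∏ i, φ i (Lagrange.basis T id (r i : F))) *
        Matrix.det (Matrix.of fun i j => (f j).eval (r i : F)) := by
  have h : (Matrix.of fun i j => φ i (f j)) = (fun i => ∑ p : T,
      φ i (Lagrange.basis T id (p : F)) • fun j => (f j).eval (p : F)) := by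
    ext i j
    simp [linearMap_eq_sum_lagrange T (φ i) (hf j), Finset.sum_apply]
  rw [h]
  refine (MultilinearMap.map_sum (Matrix.detRowAlternating (n := Fin k) (R := F)).toMultilinearMap
    _).trans ?_
  exact sum_congr rfl fun r _ => MultilinearMap.map_smul_univ _ _ _

/-- An identity between determinants of values of polynomials at generic points remains true when
the evaluations are replaced by arbitrary linear functionals. -/
theorem det_functional_eq_of_eval {k : ℕ} {κ : Type*} {s : Finset κ} {c : κ → F}
    {g : Fin k → Polynomial F} {h : κ → Fin k → Polynomial F} {S : Set F} (hS : S.Infinite)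
    (H : ∀ z : Fin k → F, Function.Injective z → (∀ i, z i ∈ S) →
      Matrix.det (Matrix.of fun i j => (g j).eval (z i)) =
        ∑ e ∈ s, c e * Matrix.det (Matrix.of fun i j => (h e j).eval (z i)))
    (φ : Fin k → Polynomial F →ₗ[F] F) :
    Matrix.det (Matrix.of fun i j => φ i (g j)) =
      ∑ e ∈ s, c e * Matrix.det (Matrix.of fun i j => φ i (h e j)) := by
  classical
  obtain ⟨d, hgd, hhd⟩ : ∃ d : ℕ, (∀ j, (g j).degree < d) ∧
      ∀ e ∈ s, ∀ j, (h e j).degree < d := by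
    refine ⟨(univ.sup fun j => (g j).natDegree) +
      (s.sup fun e => univ.sup fun j => (h e j).natDegree) + 1, fun j => ?_, fun e he j => ?_⟩
    · refine Polynomial.degree_le_natDegree.trans_lt ?_
      have := le_sup (f := fun j => (g j).natDegree) (mem_univ j)
      exact_mod_cast (by omega)
    · refine Polynomial.degree_le_natDegree.trans_lt ?_
      have h1 := le_sup (f := fun j => (h e j).natDegree) (mem_univ j)
      have h2 := le_sup (f := fun e => univ.sup fun j => (h e j).natDegree) he
      exact_mod_cast (by omega)
  obtain ⟨T, hTS, rfl⟩ := hS.exists_subset_card_eq d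
  rw [det_functional_eq_sum T φ g hgd]
  have hh : ∀ e ∈ s, c e * Matrix.det (Matrix.of fun i j => φ i (h e j)) =
      ∑ r : Fin k → T, c e * ((∏ i, φ i (Lagrange.basis T id (r i : F))) *
        Matrix.det (Matrix.of fun i j => (h e j).eval (r i : F))) := fun e he => by
    rw [det_functional_eq_sum T φ (h e) (hhd e he), mul_sum]
  rw [sum_congr rfl hh, sum_comm]
  refine sum_congr rfl fun r _ => ?_
  -- For a repeated point every determinant has two equal rows, so the hypothesis is needed at
  -- distinct points only.
  by_cases hr : Function.Injective fun i => (r i : F)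
  · rw [H _ hr fun i => hTS (r i).2, mul_sum]
    exact sum_congr rfl fun e _ => by ring
  · obtain ⟨i, j, hij, hne⟩ : ∃ i j, (r i : F) = r j ∧ i ≠ j := by
      simpa [Function.Injective] using hr
    have h0 : ∀ f : Fin k → Polynomial F,
        Matrix.det (Matrix.of fun i j => (f j).eval (r i : F)) = 0 := fun f =>
      Matrix.det_zero_of_row_eq hne (by funext a; simp [hij])
    simp [h0]

end Functionals

/-! ### The determinant identity for coefficients of power series -/

section PowerSeriesIdentity

variable {F : Type*} [Field F] {ι : Type*}

/-- The polynomial `∏_{m ∈ M} (1 - c x_m X)`. -/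
noncomputable def linPoly (x : ι → F) (M : Finset ι) (c : F) : Polynomial F :=
  ∏ m ∈ M, (1 - Polynomial.C (x m * c) * Polynomial.X)

theorem eval_linPoly (x : ι → F) (M : Finset ι) (c z : F) :
    (linPoly x M c).eval z = linProd x M (c * z) := by
  simp [linPoly, linProd, Polynomial.eval_prod, mul_assoc]

theorem constantCoeff_linPoly (x : ι → F) (M : Finset ι) (c : F) :
    PowerSeries.constantCoeff (linPoly x M c : PowerSeries F) = 1 := by
  rw [Polynomial.constantCoeff_coe, Polynomial.coeff_zero_eq_eval_zero, eval_linPoly, mul_zero,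
    linProd_zero]

/-- The coefficient of the terms of the creation operator, as a function of `J ⊆ I ⊆ M`. -/
def creationCoeff [DecidableEq ι] (x : ι → F) (t : F) (M I J : Finset ι) : F :=
  (∏ i ∈ I, ∏ j ∈ M \ I, (x i - x j / t) / (x i - x j)) * (∏ i ∈ I, x i) *
    ((-t) ^ #J * t ^ (#J).choose 2 * ∏ i ∈ J, ∏ j ∈ I \ J, (t * x i - x j) / (x i - x j))

theorem twistDet_eq_sum_creationCoeff [DecidableEq ι] {x : ι → F} {t : F}
    (hx : Function.Injective x) (hx0 : ∀ m, x m ≠ 0) (ht : t ≠ 0) (hxt : ∀ i j, x i ≠ x j * t)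
    {k : ℕ} (M : Finset ι) (z : Fin k → F) (hz : Function.Injective z) (hz0 : ∀ i, z i ≠ 0)
    (hxz : ∀ m ∈ M, ∀ i, x m * (t * z i) ≠ 1) :
    twistDet x t M z = ∑ p ∈ (powersetCard k M).sigma fun I => I.powerset,
      creationCoeff x t M p.1 p.2 * Matrix.det (Matrix.of fun i a : Fin k =>
        z i ^ ((a : ℕ) + 1) * (linProd x p.2 (z i) * linProd x (M \ p.2) (t * z i))) := by
  rw [twistDet_eq_sum hx hx0 ht M z hz hz0 hxz, sum_sigma]
  refine sum_congr rfl fun I hI => ?_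
  rw [mem_powersetCard] at hI
  rw [twistDet_eq_splitSum hx hx0 ht hxt I hI.2, splitSum, mul_sum, mul_sum]
  refine sum_congr rfl fun J hJ => ?_
  rw [mem_powerset] at hJ
  -- The part of each row independent of a comes out, leaving a Vandermonde determinant.
  have h : (Matrix.of fun i a : Fin k =>
      z i ^ ((a : ℕ) + 1) * (linProd x J (z i) * linProd x (M \ J) (t * z i))) =
      Matrix.of fun i a => (z i * (linProd x J (z i) * linProd x (M \ J) (t * z i))) *
        Matrix.vandermonde z i a := by
    ext i a
    simp only [Matrix.of_apply, Matrix.vandermonde_apply]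
    ring
  have hs : ∀ w, linProd x (M \ J) w = linProd x (M \ I) w * linProd x (I \ J) w := fun w => by
    rw [linProd_sdiff_mul x (sdiff_subset_sdiff hI.1 subset_rfl) w, sdiff_sdiff_sdiff_cancel_right hJ]
  rw [h, Matrix.det_mul_column, creationCoeff]
  simp only [hs, prod_mul_distrib]
  ring

/-- The coefficient of `X ^ N` in the product with the power series `u`. -/
noncomputable def coeffMul (u : PowerSeries F) (N : ℕ) : Polynomial F →ₗ[F] F :=
  (PowerSeries.coeff N).comp ((LinearMap.mulLeft F u).comp
    (Polynomial.coeToPowerSeries.algHom F).toLinearMap)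

theorem coeffMul_apply (u : PowerSeries F) (N : ℕ) (p : Polynomial F) :
    coeffMul u N p = PowerSeries.coeff N (u * (p : PowerSeries F)) := by
  simp [coeffMul]

theorem det_coeff_eq_sum_creationCoeff [Infinite F] [DecidableEq ι] {x : ι → F} {t : F}
    (hx : Function.Injective x) (hx0 : ∀ m, x m ≠ 0) (ht : t ≠ 0) (hxt : ∀ i j, x i ≠ x j * t)
    {k : ℕ} (M : Finset ι) (σ : PowerSeries F) (τ : Finset ι → PowerSeries F)
    (hτ : ∀ J ⊆ M, τ J * (linPoly x J t : PowerSeries F) = σ * (linPoly x J 1 : PowerSeries F))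
    (N : Fin k → ℕ) :
    Matrix.det (Matrix.of fun i a : Fin k => PowerSeries.coeff (N i)
        (PowerSeries.X ^ (a : ℕ) * (σ - t ^ (a : ℕ) • τ M))) =
      ∑ p ∈ (powersetCard k M).sigma fun I => I.powerset,
        creationCoeff x t M p.1 p.2 * Matrix.det (Matrix.of fun i a : Fin k =>
          PowerSeries.coeff (N i) (PowerSeries.X ^ ((a : ℕ) + 1) * τ p.2)) := by
  classical
  have hunit : (linPoly x M t : PowerSeries F)⁻¹ * (linPoly x M t : PowerSeries F) = 1 :=
    PowerSeries.inv_mul_cancel _ (by rw [constantCoeff_linPoly]; exact one_ne_zero)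
  have key := det_functional_eq_of_eval (k := k)
    (s := (powersetCard k M).sigma fun I => I.powerset)
    (c := fun p => creationCoeff x t M p.1 p.2)
    (g := fun a => Polynomial.X ^ (a : ℕ) *
      (linPoly x M t - t ^ (a : ℕ) • linPoly x M 1))
    (h := fun p a => Polynomial.X ^ ((a : ℕ) + 1) * (linPoly x p.2 1 * linPoly x (M \ p.2) t))
    -- The excluded points are those where `twistDet_eq_sum` does not apply: 0 and the 1/(x_m t).
    (S := ((insert 0 (M.image fun m => (x m * t)⁻¹) : Finset F) : Set F)ᶜ)
    (Set.Finite.infinite_compl (finite_toSet _)) (fun z hz hzS => ?_)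
    (fun i => coeffMul (σ * (linPoly x M t : PowerSeries F)⁻¹) (N i))
  · simp only [coeffMul_apply, Polynomial.coe_mul, Polynomial.coe_sub, Polynomial.coe_pow,
      Polynomial.coe_X, Polynomial.coe_smul] at key
    convert key using 3
    · ext i a
      have e := hτ M subset_rfl
      have e' : τ M = σ * (linPoly x M t : PowerSeries F)⁻¹ * (linPoly x M 1 : PowerSeries F) := by
        linear_combination (-τ M) * hunit + (linPoly x M t : PowerSeries F)⁻¹ * e
      congr 1
      rw [e']
      rw [PowerSeries.smul_eq_C_mul, PowerSeries.smul_eq_C_mul]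
      linear_combination (-(PowerSeries.X ^ (a : ℕ) * σ)) * hunit
    · rename_i p hp
      have hJ : p.2 ⊆ M := by
        rw [mem_sigma, mem_powersetCard, mem_powerset] at hp
        exact hp.2.trans hp.1.1
      congr 1
      ext i a
      have e := hτ p.2 hJ
      have hs : (linPoly x M t : PowerSeries F) =
          (linPoly x (M \ p.2) t : PowerSeries F) * (linPoly x p.2 t : PowerSeries F) := by
        rw [← Polynomial.coe_mul]
        exact congrArg _ (prod_sdiff hJ).symm
      simp only [Matrix.of_apply]
      congr 1
      rw [hs] at hunit ⊢
      linear_combination (-(PowerSeries.X ^ ((a : ℕ) + 1) * τ p.2)) * hunit +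
        PowerSeries.X ^ ((a : ℕ) + 1) *
        ((linPoly x (M \ p.2) t : PowerSeries F) * (linPoly x p.2 t : PowerSeries F))⁻¹ *
          (linPoly x (M \ p.2) t : PowerSeries F) * e
  · simp only [coe_insert, coe_image, Set.mem_compl_iff, Set.mem_insert_iff, Set.mem_image,
      mem_coe, not_or, not_exists, not_and] at hzS
    have := twistDet_eq_sum_creationCoeff hx hx0 ht hxt M z hz (fun i => (hzS i).1)
      (fun m hm i h => (hzS i).2 m hm (inv_eq_of_mul_eq_one_right (by rw [← h]; ring)))
    simpa only [twistDet, Polynomial.eval_mul, Polynomial.eval_pow, Polynomial.eval_X,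
      Polynomial.eval_sub, Polynomial.eval_smul, eval_linPoly, smul_eq_mul, one_mul] using this

end PowerSeriesIdentity

/-! ### The action of symmetric functions -/

theorem ratFun_algHom_ext {n : ℕ} {f g : RatFun n →ₐ[ℝ] RatFun n} (h : ∀ v, f (var v) = g (var v)) :
    f = g := by
  have hp : f.comp (IsScalarTower.toAlgHom ℝ (MvPolynomial (Var n) ℝ) (RatFun n)) =
      g.comp (IsScalarTower.toAlgHom ℝ (MvPolynomial (Var n) ℝ) (RatFun n)) :=
    MvPolynomial.algHom_ext h
  apply AlgHom.coe_ringHom_injective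
  apply IsLocalization.ringHom_ext (nonZeroDivisors (MvPolynomial (Var n) ℝ))
  exact RingHom.ext fun p => DFunLike.congr_fun hp p

theorem powerSumAction_var {n : ℕ} (i : ℕ+) (v : Var n) :
    powerSumAction i (var v) = var v ^ (i : ℕ) :=
  subst_var _ _ v

open Classical in
theorem qShift_xVar {n : ℕ} (J : Finset (Fin n)) (j : Fin n) :
    qShift J (xVar j) = if j ∈ J then qVar n * xVar j else xVar j :=
  subst_var _ _ (Var.x j)

theorem qShift_qVar {n : ℕ} (J : Finset (Fin n)) : qShift J (qVar n) = qVar n :=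
  subst_var _ _ Var.q

theorem qShift_tVar {n : ℕ} (J : Finset (Fin n)) : qShift J (tVar n) = tVar n :=
  subst_var _ _ Var.t

/-- The shift multiplies by q, and q is itself raised to the i-th power by Ψ_i; hence the two maps
agree on every indeterminate. -/
theorem powerSumAction_qShift {n : ℕ} (i : ℕ+) (J : Finset (Fin n)) (P : RatFun n) :
    powerSumAction i (qShift J P) = qShift J (powerSumAction i P) := by
  classical
  have h : (powerSumAction i).comp (qShift J) = (qShift J).comp (powerSumAction i) := by
    refine ratFun_algHom_ext fun v => ?_
    simp only [AlgHom.comp_apply, powerSumAction_var, map_pow]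
    cases v with
    | x j =>
      change powerSumAction i (qShift J (xVar j)) = qShift J (xVar j) ^ (i : ℕ)
      rw [qShift_xVar]
      split_ifs
      · rw [map_mul, mul_pow]
        exact congrArg₂ _ (powerSumAction_var i Var.q) (powerSumAction_var i (Var.x j))
      · exact powerSumAction_var i (Var.x j)
    | q =>
      change powerSumAction i (qShift J (qVar n)) = qShift J (qVar n) ^ (i : ℕ)
      rw [qShift_qVar]
      exact powerSumAction_var i Var.q
    | t =>
      change powerSumAction i (qShift J (tVar n)) = qShift J (tVar n) ^ (i : ℕ)
      rw [qShift_tVar]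
      exact powerSumAction_var i Var.t
  exact DFunLike.congr_fun h P

theorem qShift_act {n : ℕ} (J : Finset (Fin n)) (f : Sym) (P : RatFun n) :
    qShift J (f.act P) = f.act (qShift J P) := by
  have h : (qShift J).comp (MvPolynomial.aeval fun i : ℕ+ => powerSumAction i P) =
      MvPolynomial.aeval fun i : ℕ+ => powerSumAction i (qShift J P) :=
    MvPolynomial.algHom_ext fun i => by simp [powerSumAction_qShift]
  exact DFunLike.congr_fun h f

/-- The sum of the variables `x_j`, `j ∈ J`. -/
noncomputable def partialX {n : ℕ} (J : Finset (Fin n)) : RatFun n := ∑ j ∈ J, xVar j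

theorem var_injective {n : ℕ} : Function.Injective (var : Var n → RatFun n) :=
  (IsFractionRing.injective (MvPolynomial (Var n) ℝ) (RatFun n)).comp
    (MvPolynomial.X_injective (R := ℝ))

theorem xVar_injective {n : ℕ} : Function.Injective (xVar : Fin n → RatFun n) :=
  fun i j h => by injection var_injective h

theorem xVar_ne_zero {n : ℕ} (i : Fin n) : xVar i ≠ 0 := var_ne_zero _

theorem tVar_ne_zero (n : ℕ) : tVar n ≠ 0 := var_ne_zero _

theorem xVar_ne_xVar_mul_tVar {n : ℕ} (i j : Fin n) : xVar i ≠ xVar j * tVar n := by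
  intro h
  have h' : (MvPolynomial.X (Var.x i) : MvPolynomial (Var n) ℝ) =
      MvPolynomial.X (Var.x j) * MvPolynomial.X Var.t := by
    apply IsFractionRing.injective (MvPolynomial (Var n) ℝ) (RatFun n)
    rw [map_mul]
    exact h
  have := congrArg (MvPolynomial.eval fun v => match v with
    | Var.t => (2 : ℝ)
    | _ => 1) h'
  norm_num at this

theorem qVar_ne_one (n : ℕ) : qVar n ≠ 1 := by
  intro h
  have h' : (MvPolynomial.X Var.q : MvPolynomial (Var n) ℝ) = 1 := by
    apply IsFractionRing.injective (MvPolynomial (Var n) ℝ) (RatFun n)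
    rw [map_one]
    exact h
  have := congrArg (MvPolynomial.eval fun _ => (2 : ℝ)) h'
  norm_num at this

/-- The shift adds (q - 1)∑_{j∈J} x_j to X, and the factor q - 1 cancels the denominator of X^{tq}.
-/
theorem qShift_Xtq {n : ℕ} (J : Finset (Fin n)) :
    qShift J (Xtq n) = Xtq n + partialX J * (tVar n - 1) := by
  classical
  have hq : qVar n - 1 ≠ 0 := sub_ne_zero.2 (qVar_ne_one n)
  have hX : qShift J (X n) = X n + (qVar n - 1) * partialX J := by
    rw [X, map_sum, partialX, mul_sum, ← univ_inter J, ← sum_ite_mem, ← sum_add_distrib]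
    refine sum_congr rfl fun j _ => ?_
    rw [qShift_xVar, univ_inter]
    split_ifs <;> ring
  rw [Xtq, map_div₀, map_mul, map_sub, map_sub, hX, qShift_tVar, qShift_qVar, map_one]
  field_simp

/-! ### The generating series of the complete symmetric functions -/

/-- The generating series of the `S_h[P]`. -/
noncomputable def completeSeries {n : ℕ} (P : RatFun n) : PowerSeries (RatFun n) :=
  PowerSeries.mk fun h => (completeNat h).act P

/-- The generating series of the power sums `Ψ_{r+1}[P]`. -/
noncomputable def powerSumSeries {n : ℕ} (P : RatFun n) : PowerSeries (RatFun n) :=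
  PowerSeries.mk fun r => powerSumAction (Nat.succPNat r) P

theorem completeNat_succ_act {n : ℕ} (P : RatFun n) (h : ℕ) :
    (completeNat (h + 1)).act P * (h + 1) =
      ∑ p ∈ antidiagonal h, powerSumAction (Nat.succPNat p.1) P * (completeNat p.2).act P := by
  rw [completeNat, Sym.act, map_mul, map_sum, MvPolynomial.aeval_C,
    Finset.Nat.sum_antidiagonal_eq_sum_range_succ_mk, ← Fin.sum_univ_eq_sum_range
      (fun r => powerSumAction (Nat.succPNat r) P * (completeNat (h - r)).act P)]
  have hh : algebraMap ℝ (RatFun n) (1 / (h + 1)) * (h + 1) = 1 := by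
    rw [show ((h : RatFun n) + 1) = algebraMap ℝ (RatFun n) (h + 1) by simp, ← map_mul,
      one_div_mul_cancel (by positivity), map_one]
  rw [mul_right_comm, hh, one_mul]
  refine sum_congr rfl fun r _ => ?_
  rw [map_mul, MvPolynomial.aeval_X]
  rfl

theorem constantCoeff_completeSeries {n : ℕ} (P : RatFun n) :
    PowerSeries.constantCoeff (completeSeries P) = 1 := by
  rw [← PowerSeries.coeff_zero_eq_constantCoeff_apply, completeSeries, PowerSeries.coeff_mk,
    completeNat, Sym.act, map_one]

/-- The recursion defining the complete functions is this differential equation; with constant term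
1 it characterizes the series (`completeSeries_eq`). -/
theorem derivative_completeSeries {n : ℕ} (P : RatFun n) :
    PowerSeries.derivative (RatFun n) (completeSeries P) = powerSumSeries P * completeSeries P := by
  ext h
  rw [PowerSeries.coeff_derivative, PowerSeries.coeff_mul, completeSeries, powerSumSeries,
    PowerSeries.coeff_mk, completeNat_succ_act]
  simp

theorem eq_of_derivative_eq_mul {F : Type*} [Field F] [CharZero F] {f g u : PowerSeries F}
    (hf : PowerSeries.derivative F f = u * f) (hg : PowerSeries.derivative F g = u * g)
    (h : PowerSeries.constantCoeff f = PowerSeries.constantCoeff g) : f = g := by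
  ext m
  induction m using Nat.strong_induction_on with
  | _ m ih =>
    cases m with
    | zero => simpa using h
    | succ m =>
      have hf' := congrArg (PowerSeries.coeff m) hf
      have hg' := congrArg (PowerSeries.coeff m) hg
      rw [PowerSeries.coeff_derivative, PowerSeries.coeff_mul] at hf' hg'
      refine mul_right_cancel₀ (b := (m : F) + 1) (Nat.cast_add_one_ne_zero m) ?_
      rw [hf', hg']
      refine sum_congr rfl fun p hp => ?_
      rw [ih p.2 (Nat.lt_succ_of_le (by have := mem_antidiagonal.1 hp; omega))]

theorem completeSeries_eq {n : ℕ} {P : RatFun n} {f : PowerSeries (RatFun n)}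
    (hf : PowerSeries.derivative (RatFun n) f = powerSumSeries P * f)
    (h : PowerSeries.constantCoeff f = 1) : completeSeries P = f :=
  eq_of_derivative_eq_mul (derivative_completeSeries P) hf
    ((constantCoeff_completeSeries P).trans h.symm)

/-- Power sums act additively, so the product solves the differential equation of the sum. -/
theorem completeSeries_add {n : ℕ} (P Q : RatFun n) :
    completeSeries (P + Q) = completeSeries P * completeSeries Q := by
  refine completeSeries_eq ?_ (by simp [constantCoeff_completeSeries])
  have h : powerSumSeries (P + Q) = powerSumSeries P + powerSumSeries Q := by
    ext
    simp [powerSumSeries]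
  rw [Derivation.leibniz, derivative_completeSeries, derivative_completeSeries, h, smul_eq_mul,
    smul_eq_mul]
  ring

theorem completeSeries_zero {n : ℕ} : completeSeries (0 : RatFun n) = 1 := by
  refine completeSeries_eq ?_ (by simp)
  have h : powerSumSeries (0 : RatFun n) = 0 := by
    ext
    simp [powerSumSeries]
  rw [h]
  simp

/-- For u on which Ψ_i acts as the i-th power, the geometric series in u solves the differential
equation. -/
theorem completeSeries_mul_one_sub {n : ℕ} {u : RatFun n}
    (hu : ∀ i : ℕ+, powerSumAction i u = u ^ (i : ℕ)) :
    completeSeries u * (1 - PowerSeries.C u * PowerSeries.X) = 1 := by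
  have hmk : (PowerSeries.mk fun h => u ^ h) * (1 - PowerSeries.C u * PowerSeries.X) = 1 := by
    ext h
    cases h with
    | zero => simp [mul_sub, ← mul_assoc]
    | succ h =>
      rw [mul_sub, mul_one, ← mul_assoc, map_sub, PowerSeries.coeff_succ_mul_X]
      simp [PowerSeries.coeff_one, pow_succ]
  have hs : powerSumSeries u = PowerSeries.C u * PowerSeries.mk fun h => u ^ h := by
    ext h
    simp [powerSumSeries, hu, pow_succ']
  have h : completeSeries u = PowerSeries.mk fun h => u ^ h := by
    refine completeSeries_eq ?_ (by simp [← PowerSeries.coeff_zero_eq_constantCoeff_apply])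
    have hd := congrArg (PowerSeries.derivative (RatFun n)) hmk
    simp only [Derivation.leibniz, map_sub, Derivation.map_one_eq_zero, PowerSeries.derivative_X,
      PowerSeries.derivative_C, smul_eq_mul] at hd
    rw [hs]
    linear_combination (PowerSeries.mk fun h => u ^ h) * hd -
      (PowerSeries.derivative (RatFun n) (PowerSeries.mk fun h => u ^ h)) * hmk
  rw [h, hmk]

theorem completeSeries_partialX_mul {n : ℕ} (J : Finset (Fin n)) {c : RatFun n}
    (hc : ∀ i : ℕ+, powerSumAction i c = c ^ (i : ℕ)) :
    completeSeries (partialX J * c) * (linPoly xVar J c : PowerSeries (RatFun n)) = 1 := by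
  classical
  induction J using Finset.induction_on with
  | empty => simp [partialX, linPoly, completeSeries_zero]
  | insert j J hj ih =>
    have h := completeSeries_mul_one_sub (u := xVar j * c) fun i => by
      rw [map_mul, hc, mul_pow]
      exact congrArg (· * _) (powerSumAction_var i (Var.x j))
    rw [linPoly] at ih ⊢
    rw [partialX, sum_insert hj, prod_insert hj, add_mul, completeSeries_add, Polynomial.coe_mul]
    rw [partialX] at ih
    simp only [Polynomial.coe_sub, Polynomial.coe_one, Polynomial.coe_mul, Polynomial.coe_C,
      Polynomial.coe_X] at ih ⊢
    rw [mul_mul_mul_comm, ih, h, one_mul]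

theorem completeSeries_add_partialX {n : ℕ} (P : RatFun n) (J : Finset (Fin n)) :
    completeSeries (P + partialX J * (tVar n - 1)) *
        (linPoly xVar J (tVar n) : PowerSeries (RatFun n)) =
      completeSeries P * (linPoly xVar J 1 : PowerSeries (RatFun n)) := by
  have h1 := completeSeries_partialX_mul J (c := tVar n) fun i => powerSumAction_var i Var.t
  have h2 := completeSeries_partialX_mul J (c := 1) fun i => by simp
  have h3 := completeSeries_add (P + partialX J * (tVar n - 1)) (partialX J * 1)
  rw [show P + partialX J * (tVar n - 1) + partialX J * 1 = P + partialX J * tVar n by ring,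
    completeSeries_add P] at h3
  linear_combination completeSeries P * (linPoly xVar J 1 : PowerSeries (RatFun n)) * h1 -
    (linPoly xVar J 1 : PowerSeries (RatFun n)) *
      (linPoly xVar J (tVar n) : PowerSeries (RatFun n)) * h3 -
    completeSeries (P + partialX J * (tVar n - 1)) *
      (linPoly xVar J (tVar n) : PowerSeries (RatFun n)) * h2

/-- The factor X^a absorbs the index shift, and a > N gives coefficient 0, in accordance with S_h =
0 for h < 0. -/
theorem complete_act_eq_coeff {n : ℕ} (P : RatFun n) {h : ℤ} {N a : ℕ} (hN : h = N - a) :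
    (complete h).act P = PowerSeries.coeff N (PowerSeries.X ^ a * completeSeries P) := by
  rw [PowerSeries.coeff_X_pow_mul']
  split_ifs with ha
  · obtain rfl : h = Int.ofNat (N - a) := by rw [hN, Int.ofNat_eq_natCast, Nat.cast_sub ha]
    rw [completeSeries, PowerSeries.coeff_mk]
    rfl
  · obtain ⟨m, rfl⟩ : ∃ m, h = Int.negSucc m := Int.eq_negSucc_of_lt_zero (by omega)
    exact map_zero _

/-! ### Jacobi–Trudi determinants of larger size -/

theorem rowLen_eq_zero {μ : YoungDiagram} {k : ℕ} (h : numParts μ ≤ k) : μ.rowLen k = 0 := by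
  by_contra h0
  have h1 : (k, 0) ∈ μ := YoungDiagram.mem_iff_lt_rowLen.2 (Nat.pos_of_ne_zero h0)
  exact absurd (YoungDiagram.mem_iff_lt_colLen.1 h1) (not_lt.2 h)

theorem complete_zero : complete 0 = 1 := by
  change completeNat 0 = 1
  rw [completeNat]

theorem complete_of_neg {h : ℤ} (hh : h < 0) : complete h = 0 := by
  obtain ⟨m, rfl⟩ := Int.eq_negSucc_of_lt_zero hh
  rfl

theorem schur_eq_det {μ : YoungDiagram} {k : ℕ} (h : numParts μ ≤ k) :
    schur μ = Matrix.det (Matrix.of fun i j : Fin k =>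
      complete ((μ.rowLen i : ℤ) - (i : ℕ) + (j : ℕ))) := by
  induction k, h using Nat.le_induction with
  | base => rfl
  | succ k hk ih =>
    -- The added row belongs to a zero part, so it is (0, …, 0, 1): negative indices left of the
    -- diagonal, S_0 on it.
    rw [ih, Matrix.det_succ_row _ (Fin.last k), Fin.sum_univ_castSucc, sum_eq_zero, zero_add]
    · have h1 : (μ.rowLen k : ℤ) - (k : ℕ) + (k : ℕ) = 0 := by simp [rowLen_eq_zero hk]
      simp only [Matrix.of_apply, Fin.val_last, h1, complete_zero, mul_one, ← two_mul, pow_mul,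
        neg_one_sq, one_pow, one_mul]
      congr 1
      ext1 i j
      simp
    · intro j _
      rw [Matrix.of_apply, complete_of_neg]
      · simp
      · simp [rowLen_eq_zero hk]

theorem schur_act_eq_det {n : ℕ} {μ : YoungDiagram} {k : ℕ} (h : numParts μ ≤ k) (P : RatFun n) :
    (schur μ).act P = Matrix.det (Matrix.of fun i j : Fin k =>
      (complete ((μ.rowLen i : ℤ) - (i : ℕ) + (j : ℕ))).act P) := by
  rw [schur_eq_det h, Sym.act, AlgHom.map_det]
  rfl

/-! ### Evaluation of column operators -/

theorem evalDet_single {n k : ℕ} (A : FormalMatrix n k) :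
    evalDet (Finsupp.single A 1) =
      Matrix.det (Matrix.of fun i j => (complete (A i j).1).act (A i j).2) := by
  simp [evalDet]

theorem columnFactor_single {n k : ℕ} (a : Fin k) (A : FormalMatrix n k) :
    columnFactor n a (Finsupp.single A 1) =
      Finsupp.single (shiftColumns (Pi.single a 1) 0 A) 1 -
        tVar n ^ (k - ((a : ℕ) + 1)) •
          Finsupp.single (shiftColumns (Pi.single a 1) (Pi.single a (Xt n)) A) 1 := by
  rw [columnFactor, LinearMap.sub_apply, LinearMap.smul_apply, columnOp, columnOp,
    Finsupp.lmapDomain_apply, Finsupp.lmapDomain_apply, Finsupp.mapDomain_single,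
    Finsupp.mapDomain_single]

/-- Stated for any list of distinct columns so that induction applies. The rightmost factor acts
first, on a column the others leave alone, and linearity of the determinant in that column merges
its two terms. -/
theorem evalDet_prod_columnFactor {n k : ℕ} (L : List (Fin k)) (hL : L.Nodup)
    (A : FormalMatrix n k) :
    evalDet ((L.map fun a => columnFactor n a).prod (Finsupp.single A 1)) =
      Matrix.det (Matrix.of fun i j => if j ∈ L then
        (complete ((A i j).1 + 1)).act (A i j).2 -
          tVar n ^ (k - ((j : ℕ) + 1)) * (complete ((A i j).1 + 1)).act ((A i j).2 + Xt n)
        else (complete (A i j).1).act (A i j).2) := by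
  induction L using List.reverseRecOn generalizing A with
  | nil => simp [evalDet_single]
  | append_singleton L a ih =>
    have hL' : L.Nodup := (List.nodup_append.1 hL).1
    have haL : a ∉ L := fun h => (List.nodup_append.1 hL).2.2 a h a (by simp) rfl
    rw [List.map_append, List.prod_append, Module.End.mul_apply, List.map_singleton,
      List.prod_singleton, columnFactor_single, map_sub, map_smul, map_sub, map_smul, ih hL',
      ih hL']
    set M : Matrix (Fin k) (Fin k) (RatFun n) := Matrix.of fun i j => if j ∈ L ++ [a] then
        (complete ((A i j).1 + 1)).act (A i j).2 -
          tVar n ^ (k - ((j : ℕ) + 1)) * (complete ((A i j).1 + 1)).act ((A i j).2 + Xt n)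
        else (complete (A i j).1).act (A i j).2 with hM
    have h0 : M = M.updateCol a ((fun i => (complete ((A i a).1 + 1)).act (A i a).2) +
        (-tVar n ^ (k - ((a : ℕ) + 1))) •
          fun i => (complete ((A i a).1 + 1)).act ((A i a).2 + Xt n)) := by
      ext i j
      by_cases hj : j = a
      · subst hj
        simp [hM, sub_eq_add_neg]
      · simp [hj]
    rw [h0, Matrix.det_updateCol_add, Matrix.det_updateCol_smul, smul_eq_mul, neg_mul,
      ← sub_eq_add_neg]
    congr 2
    · congr 1
      ext i j
      by_cases hj : j = a
      · subst hj
        simp [shiftColumns, haL]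
      · simp [shiftColumns, hj, hM]
    · congr 1
      ext i j
      by_cases hj : j = a
      · subst hj
        simp [shiftColumns, haL]
      · simp [shiftColumns, hj, hM]

theorem evalDet_columnProduct {n k : ℕ} (A : FormalMatrix n k) :
    evalDet (columnProduct n k (Finsupp.single A 1)) =
      Matrix.det (Matrix.of fun i j : Fin k =>
        (complete ((A i j).1 + 1)).act (A i j).2 -
          tVar n ^ (k - ((j : ℕ) + 1)) * (complete ((A i j).1 + 1)).act ((A i j).2 + Xt n)) := by
  rw [columnProduct, List.ofFn_eq_map, evalDet_prod_columnFactor _ (List.nodup_finRange k)]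
  simp

/-! ### The creation operator on Schur functions -/

theorem creationOp_eq_sum {n k : ℕ} (f : RatFun n) :
    creationOp n k f = ∑ p ∈ (powersetCard k (univ : Finset (Fin n))).sigma fun I => I.powerset,
      creationCoeff xVar (tVar n) univ p.1 p.2 * qShift p.2 f := by
  rw [creationOp, sum_sigma]
  refine sum_congr rfl fun I hI => ?_
  rw [mem_powersetCard] at hI
  -- The sums over l and over J with |J| = l together run over all subsets of I.
  rw [sum_powerset, hI.2]
  refine sum_congr rfl fun l _ => ?_
  rw [macdonaldOp, mul_sum, mul_sum]
  refine sum_congr rfl fun J hJ => ?_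
  rw [mem_powersetCard] at hJ
  simp only [creationCoeff, resultant, ← prod_div_distrib, hJ.2, compl_eq_univ_sdiff]
  ring

theorem det_rev {R : Type*} [CommRing R] {k : ℕ} (f : Fin k → Fin k → R) :
    Matrix.det (Matrix.of fun i j => f i (Fin.rev j)) =
      (Equiv.Perm.sign (Fin.revPerm (n := k)) : R) * Matrix.det (Matrix.of f) := by
  rw [← Matrix.det_permute']
  rfl

/-- Reversing the columns makes a = k - 1 - j the exponent of X. The sign of the reversal also
appears in `det_G_eq`, so it cancels in the comparison. -/
theorem qShift_schur_act {n k : ℕ} {μ : YoungDiagram} (hμ : numParts μ ≤ k)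
    (J : Finset (Fin n)) :
    qShift J ((schur μ).act (Xtq n)) = (Equiv.Perm.sign (Fin.revPerm (n := k)) : RatFun n) *
      Matrix.det (Matrix.of fun i a : Fin k => PowerSeries.coeff (μ.rowLen i + k - i)
        (PowerSeries.X ^ ((a : ℕ) + 1) *
          completeSeries (Xtq n + partialX J * (tVar n - 1)))) := by
  rw [qShift_act, qShift_Xtq, schur_act_eq_det hμ, ← det_rev]
  congr 1
  ext i j
  exact complete_act_eq_coeff _ (by rw [Fin.val_rev]; omega)

theorem G_Xtq_sub_X {n : ℕ} (h : ℤ) (r : ℕ) :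
    G (Xtq n - X n) h r = (complete h).act (Xtq n) -
      tVar n ^ r * (complete h).act (Xtq n + Xt n) := by
  rw [G, sub_add_cancel]

theorem det_G_eq {n k : ℕ} (μ : YoungDiagram) :
    Matrix.det (Matrix.of fun i j : Fin k => G (Xtq n - X n)
        ((μ.rowLen i : ℤ) - (i : ℕ) + (j : ℕ) + 1) (k - ((j : ℕ) + 1))) =
      (Equiv.Perm.sign (Fin.revPerm (n := k)) : RatFun n) *
        Matrix.det (Matrix.of fun i a : Fin k => PowerSeries.coeff (μ.rowLen i + k - i)
          (PowerSeries.X ^ (a : ℕ) * (completeSeries (Xtq n) - tVar n ^ (a : ℕ) •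
            completeSeries (Xtq n + partialX univ * (tVar n - 1))))) := by
  rw [← det_rev]
  refine congrArg Matrix.det (Matrix.ext fun i j => ?_)
  -- With N_i = λ_i + k - i (i from 0), the index of G is N_i - (k - 1 - j), and k - 1 - j is also
  -- its exponent of t.
  have h : ((μ.rowLen i : ℤ) - (i : ℕ) + (j : ℕ) + 1) =
      ((μ.rowLen i + k - i : ℕ) : ℤ) - (Fin.rev j : ℕ) := by rw [Fin.val_rev]; omega
  have hX : Xt n = partialX univ * (tVar n - 1) := by rw [Xt, X, partialX]
  rw [Matrix.of_apply, Matrix.of_apply, G_Xtq_sub_X, complete_act_eq_coeff _ h,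
    complete_act_eq_coeff _ h, hX, mul_sub (PowerSeries.X ^ _), mul_smul_comm, map_sub, map_smul, smul_eq_mul,
    Fin.val_rev]

theorem creationOp_schur_eq_det_G {n k : ℕ} {μ : YoungDiagram} (hμ : numParts μ ≤ k) :
    creationOp n k ((schur μ).act (Xtq n)) =
      Matrix.det (Matrix.of fun i j : Fin k => G (Xtq n - X n)
        ((μ.rowLen i : ℤ) - (i : ℕ) + (j : ℕ) + 1) (k - ((j : ℕ) + 1))) := by
  have : Infinite (RatFun n) := Infinite.of_injective _ (algebraMap ℝ (RatFun n)).injective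
  rw [det_G_eq, creationOp_eq_sum, det_coeff_eq_sum_creationCoeff xVar_injective xVar_ne_zero
    (tVar_ne_zero n) xVar_ne_xVar_mul_tVar univ (completeSeries (Xtq n))
    (fun J => completeSeries (Xtq n + partialX J * (tVar n - 1)))
    (fun J _ => completeSeries_add_partialX (Xtq n) J), mul_sum]
  refine sum_congr rfl fun p _ => ?_
  rw [qShift_schur_act hμ]
  ring

theorem evalDet_columnProduct_jacobiTrudi {n k : ℕ} (μ : YoungDiagram) :
    evalDet (columnProduct n k (Finsupp.single (jacobiTrudi k μ (Xtq n)) 1)) =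
      Matrix.det (Matrix.of fun i j : Fin k => G (Xtq n - X n)
        ((μ.rowLen i : ℤ) - (i : ℕ) + (j : ℕ) + 1) (k - ((j : ℕ) + 1))) := by
  rw [evalDet_columnProduct]
  refine congrArg Matrix.det (Matrix.ext fun i j => ?_)
  rw [Matrix.of_apply, Matrix.of_apply, G_Xtq_sub_X, jacobiTrudi, Matrix.of_apply]

end CreationOperator

theorem theorem4p2 (n k : ℕ) (hkn : k ≤ n) (μ : YoungDiagram)
    (hμ : CreationOperator.numParts μ ≤ k) :
    CreationOperator.creationOp n k
        ((CreationOperator.schur μ).act (CreationOperator.Xtq n)) =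
      CreationOperator.evalDet (CreationOperator.columnProduct n k
        (Finsupp.single
          (CreationOperator.jacobiTrudi k μ (CreationOperator.Xtq n)) 1)) ∧
    CreationOperator.creationOp n k
        ((CreationOperator.schur μ).act (CreationOperator.Xtq n)) =
      Matrix.det (Matrix.of fun i j : Fin k =>
        CreationOperator.G (CreationOperator.Xtq n - CreationOperator.X n)
          ((μ.rowLen i : ℤ) - (i : ℕ) + (j : ℕ) + 1) (k - ((j : ℕ) + 1))) := by
  rw [CreationOperator.evalDet_columnProduct_jacobiTrudi]
  exact ⟨CreationOperator.creationOp_schur_eq_det_G hμ,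
    CreationOperator.creationOp_schur_eq_det_G hμ⟩
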